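/- A multi-digraph is a finite directed graph in which parallel edges are allowed; it is Eulerian if every vertex has in-degree equal to its out-degree (counted with multiplicities). Write $\overrightarrow{K}_s$ for the complete digraph on $s$ vertices, which has exactly one edge from $x$ to $y$ for every ordered pair of distinct vertices $x, y$. A multi-digraph $D$ immerses a digraph $H$ if there are an injection $f : V(H) \to V(D)$ and pairwise edge-disjoint directed paths $P_e$ in $D$, one for each edge $e$ of $H$, such that for every edge $e = uv$ of $H$ the path $P_e$ starts at $f(u)$ and ends at $f(v)$. Theorem 4.3. Let $\alpha \ge 0$ be a real number, and let $D$ be an Eulerian multi-digraph on $n$ vertices whose underlying simple graph, obtained from $D$ by ignoring directions and multiplicities, has minimum degree at least $\alpha n$. Then $D$ immerses $\overrightarrow{K}_s$, where $s = \lceil 10^{-9} \alpha^4 n \rceil$. -/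

import Mathlib

/-- A directed multigraph with vertex set `V` and edge set `E`: every edge has a source and a
target. Parallel edges (and loops) are allowed. -/
structure MultiDigraph (V E : Type*) where
  /-- The vertex at which an edge starts. -/
  src : E → V
  /-- The vertex at which an edge ends. -/
  tgt : E → V

namespace MultiDigraph

/-- The number of edges ending at `v`, counted with multiplicities. -/
noncomputable def inDegree {V E : Type*} (D : MultiDigraph V E) (v : V) : ℕ :=
  Nat.card {e : E // D.tgt e = v}

/-- The number of edges starting at `v`, counted with multiplicities. -/
noncomputable def outDegree {V E : Type*} (D : MultiDigraph V E) (v : V) : ℕ :=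
  Nat.card {e : E // D.src e = v}

/-- A (finite) multi-digraph is Eulerian if every vertex has equal in-degree and out-degree. -/
def IsEulerian {V E : Type*} (D : MultiDigraph V E) : Prop :=
  ∀ v : V, D.inDegree v = D.outDegree v

/-- The simple graph obtained by ignoring directions and multiplicities (and loops). -/
def underlyingSimpleGraph {V E : Type*} (D : MultiDigraph V E) : SimpleGraph V :=
  SimpleGraph.fromRel (fun x y => ∃ e : E, D.src e = x ∧ D.tgt e = y)

/-- `D.IsWalk u p v`: the consecutive edges in the list `p` form a directed walk from `u` to
`v`. -/
def IsWalk {V E : Type*} (D : MultiDigraph V E) : V → List E → V → Prop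
  | u, [], v => u = v
  | u, e :: p, v => D.src e = u ∧ D.IsWalk (D.tgt e) p v

/-- `D.IsPath u p v`: the list of edges `p` forms a directed path from `u` to `v`, that is, a
directed walk that visits no vertex twice. -/
def IsPath {V E : Type*} (D : MultiDigraph V E) (u : V) (p : List E) (v : V) : Prop :=
  D.IsWalk u p v ∧ (u :: p.map D.tgt).Nodup

/-- `D.Immerses H`: there are an injection `f` from the vertices of `H` to those of `D` and
pairwise edge-disjoint directed paths `P e` in `D`, one for each edge `e` of `H`, such that for
an edge `e` from `u` to `v` the path `P e` starts at `f u` and ends at `f v`. -/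
def Immerses {V E W F : Type*} (D : MultiDigraph V E) (H : MultiDigraph W F) : Prop :=
  ∃ (f : W → V) (P : F → List E), Function.Injective f ∧
    (∀ e : F, D.IsPath (f (H.src e)) (P e) (f (H.tgt e))) ∧
    Pairwise (fun e e' : F => (P e).Disjoint (P e'))

/-- The complete digraph on `s` vertices: exactly one edge from `x` to `y` for every ordered pair
of distinct vertices `x`, `y`. -/
def complete (s : ℕ) : MultiDigraph (Fin s) {p : Fin s × Fin s // p.1 ≠ p.2} where
  src p := p.1.1
  tgt p := p.1.2

end MultiDigraph

/-! Pairwise edge-disjoint walks suffice, since each walk contains a path on a subset of its edges.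
The Eulerian condition enters as a permutation `σ` of the edges sending each edge to one that starts
where it ends.

Let `n` be the number of vertices, `α = 2c`, and `G` the underlying simple graph.
`exists_cut_dense_set` gives a set `U` on which `G` has about its original density and no sparse cut
with two large sides. Fix one representative edge of `D` for each edge of `G[U]`. At any vertex with
a non-representative edge in and another out, fuse the two into one edge (`exists_reduction`). In
the final digraph every vertex has, on one side, only representatives. In-degrees equal out-degrees,
so all degrees are at most `n`, and at most `n |U|` edges remain. Every cut with two large sides in
`U` carries order `c² n²` edges, half of them in each direction. Breadth-first search therefore
joins any two large subsets of `U` by a walk of length `O(c⁻²)`, even after deleting a small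
multiple of `c² n²` edges (`exists_short_walk`).

The remaining difficulty is entering a branch vertex: it may have many representatives leaving it
but none arriving. Let `F` consist of the representatives whose source has large out-degree. From
each edge of `F`, follow `σ` to the next edge of `F` (`exists_returns`). These return walks are
disjoint, and most are short because their total length is at most `n |U|`. By averaging
(`exists_terminals`), `s` vertices each receive `s` short returns, all starting in a small set `Y`
of vertices with many incoming edges of `F`. Entering a branch vertex thus reduces to entering a
vertex of `Y`, and the required connections are made greedily (`exists_disjoint_connections`). -/

namespace MultiDigraph

/-! ### Walks, paths and the successor permutation of an Eulerian digraph. -/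

section Walks

variable {V E E' : Type*} {D : MultiDigraph V E} {D' : MultiDigraph V E'}

theorem IsWalk.append {u v w : V} {p q : List E} (hp : D.IsWalk u p v) (hq : D.IsWalk v q w) :
    D.IsWalk u (p ++ q) w := by
  induction p generalizing u with
  | nil => obtain rfl : u = v := hp; exact hq
  | cons e p ih => exact ⟨hp.1, ih hp.2⟩

theorem isWalk_singleton (e : E) : D.IsWalk (D.src e) [e] (D.tgt e) := ⟨rfl, rfl⟩

theorem IsPath.exists_suffix {u v w : V} {p : List E} (hp : D.IsPath w p v)
    (hu : u ∈ w :: p.map D.tgt) : ∃ q, q ⊆ p ∧ D.IsPath u q v := by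
  induction p generalizing w with
  | nil =>
    obtain rfl : u = w := by simpa using hu
    exact ⟨[], List.Subset.refl _, hp⟩
  | cons e p ih =>
    rcases List.mem_cons.1 hu with rfl | hu
    · exact ⟨e :: p, List.Subset.refl _, hp⟩
    · obtain ⟨q, hq, hq'⟩ := ih (w := D.tgt e) ⟨hp.1.2, (List.nodup_cons.1 hp.2).2⟩ hu
      exact ⟨q, fun x hx => List.mem_cons_of_mem _ (hq hx), hq'⟩

theorem IsWalk.exists_path {u v : V} {p : List E} (hp : D.IsWalk u p v) :
    ∃ q, q ⊆ p ∧ D.IsPath u q v := by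
  induction p generalizing u with
  | nil => exact ⟨[], List.Subset.refl _, hp, by simp⟩
  | cons e p ih =>
    obtain ⟨q, hqp, hq⟩ := ih hp.2
    by_cases hu : u ∈ D.tgt e :: q.map D.tgt
    · obtain ⟨q', hq', h⟩ := hq.exists_suffix hu
      exact ⟨q', fun x hx => List.mem_cons_of_mem _ (hqp (hq' hx)), h⟩
    · exact ⟨e :: q, List.cons_subset_cons e hqp, ⟨hp.1, hq.1⟩, List.nodup_cons.2 ⟨hu, hq.2⟩⟩

/-- `D'` arises from `D` by replacing pairwise edge-disjoint walks by single edges. -/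
def WalkImmerses (D : MultiDigraph V E) (D' : MultiDigraph V E') : Prop :=
  ∃ φ : E' → List E, (∀ e, D.IsWalk (D'.src e) (φ e) (D'.tgt e)) ∧
    Pairwise (fun e e' => (φ e).Disjoint (φ e'))

theorem WalkImmerses.refl (D : MultiDigraph V E) : D.WalkImmerses D :=
  ⟨fun e => [e], isWalk_singleton, fun e e' h => by simpa using h.symm⟩

theorem IsWalk.flatMap {φ : E' → List E}
    (hφ : ∀ e, D.IsWalk (D'.src e) (φ e) (D'.tgt e)) {u v : V} {p : List E'}
    (hp : D'.IsWalk u p v) : D.IsWalk u (p.flatMap φ) v := by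
  induction p generalizing u with
  | nil => exact hp
  | cons e p ih =>
    obtain ⟨rfl, h⟩ := hp
    exact (hφ e).append (ih h)

theorem disjoint_flatMap {φ : E' → List E}
    (hφ : Pairwise (fun e e' => (φ e).Disjoint (φ e'))) {p q : List E'} (h : p.Disjoint q) :
    (p.flatMap φ).Disjoint (q.flatMap φ) := by
  intro x hx hx'
  obtain ⟨a, ha, hxa⟩ := List.mem_flatMap.1 hx
  obtain ⟨b, hb, hxb⟩ := List.mem_flatMap.1 hx'
  have hab : a ≠ b := by rintro rfl; exact h ha hb
  exact hφ hab hxa hxb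

theorem WalkImmerses.trans {E'' : Type*} {D'' : MultiDigraph V E''} (h : D.WalkImmerses D')
    (h' : D'.WalkImmerses D'') : D.WalkImmerses D'' := by
  obtain ⟨φ, hφ, hd⟩ := h
  obtain ⟨ψ, hψ, hd'⟩ := h'
  exact ⟨fun e => (ψ e).flatMap φ, fun e => (hψ e).flatMap hφ,
    fun e e' he => disjoint_flatMap hd (hd' he)⟩

/-- Expanding edges into walks preserves edge-disjointness, and so does shortcutting each walk to a
path. Hence all later constructions need only walks. -/
theorem WalkImmerses.immerses_of_walks {W F : Type*} {H : MultiDigraph W F}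
    (h : D.WalkImmerses D') (f : W → V) (hf : Function.Injective f) (P : F → List E')
    (hP : ∀ e, D'.IsWalk (f (H.src e)) (P e) (f (H.tgt e)))
    (hd : Pairwise (fun e e' => (P e).Disjoint (P e'))) : D.Immerses H := by
  obtain ⟨φ, hφ, hdφ⟩ := h
  choose Q hQ hQ' using fun e => ((hP e).flatMap hφ).exists_path
  exact ⟨f, Q, hf, hQ', fun e e' he x hx hx' =>
    disjoint_flatMap hdφ (hd he) (hQ e hx) (hQ e' hx')⟩

/-- Match incoming with outgoing edges at each vertex. The cycles of the resulting permutation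
decompose the digraph into closed trails. -/
theorem IsEulerian.exists_perm [Finite E] (hD : D.IsEulerian) :
    ∃ σ : Equiv.Perm E, ∀ e, D.src (σ e) = D.tgt e := by
  have h : ∀ v, Nonempty ({e // D.tgt e = v} ≃ {e // D.src e = v}) := fun v =>
    (Finite.card_eq).1 (hD v)
  exact ⟨Equiv.ofFiberEquiv fun v => (h v).some, fun e => Equiv.ofFiberEquiv_map _ e⟩

end Walks

/-! ### Splitting off superfluous edges. -/

section Reduction

universe u
variable {V : Type*}

/-- Splitting off pairs of edges not used as representatives of the edges of `G`, until at every
vertex all incoming or all outgoing edges are representatives. -/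
theorem exists_reduction (G : SimpleGraph V) (m : ℕ) :
    ∀ (E : Type u) [Fintype E], Fintype.card E ≤ m → ∀ (D : MultiDigraph V E)
      (σ : Equiv.Perm E) (_ : ∀ e, D.src (σ e) = D.tgt e) (r : G.edgeSet → E)
      (_ : ∀ x, s(D.src (r x), D.tgt (r x)) = x.1),
    ∃ (E' : Type u) (_ : Fintype E') (D' : MultiDigraph V E') (σ' : Equiv.Perm E')
      (r' : G.edgeSet → E'), (∀ e, D'.src (σ' e) = D'.tgt e) ∧
      (∀ x, s(D'.src (r' x), D'.tgt (r' x)) = x.1) ∧ D.WalkImmerses D' ∧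
      ∀ v, (∀ e, D'.tgt e = v → e ∈ Set.range r') ∨ (∀ e, D'.src e = v → e ∈ Set.range r') := by
  classical
  induction m with
  | zero =>
    intro E _ hE D σ hσ r hr
    have : IsEmpty E := Fintype.card_eq_zero_iff.1 (by omega)
    exact ⟨E, inferInstance, D, σ, r, hσ, hr, .refl D, fun v => .inl fun e => isEmptyElim e⟩
  | succ m ih =>
    intro E _ hE D σ hσ r hr
    by_cases hmin : ∀ v, (∀ e, D.tgt e = v → e ∈ Set.range r) ∨
        (∀ e, D.src e = v → e ∈ Set.range r)
    · exact ⟨E, inferInstance, D, σ, r, hσ, hr, .refl D, hmin⟩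
    push Not at hmin
    obtain ⟨v, ⟨e, he, her⟩, f, hf, hfr⟩ := hmin
    -- `σ₁` makes `f` the successor of `e`; this is legitimate because `σ e` and `f` both start at
    -- `v`. Then `σ₂` cuts `f` out of its cycle, so it restricts to the edges other than `f`. If `e
    -- = f` is a loop, it is simply dropped.
    set σ₁ : Equiv.Perm E := Equiv.swap (σ e) f * σ with hσ₁
    have hσ₁e : σ₁ e = f := by simp [hσ₁]
    have hsrc₁ : ∀ x, D.src (σ₁ x) = D.tgt x := by
      intro x
      rw [← hσ x, hσ₁, Equiv.Perm.mul_apply, Equiv.swap_apply_def]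
      split_ifs with h1 h2
      · rw [h1, hσ e, he, hf]
      · rw [h2, hσ e, he, hf]
      · rfl
    set σ₂ : Equiv.Perm E := Equiv.swap f (σ₁ f) * σ₁ with hσ₂
    have hσ₂f : σ₂ f = f := by simp [hσ₂]
    have hσ₂' : ∀ x, x ≠ f ↔ σ₂ x ≠ f := fun x => by
      rw [not_iff_not]
      constructor
      · rintro rfl; exact hσ₂f
      · intro h; exact σ₂.injective (h.trans hσ₂f.symm)
    let D₁ : MultiDigraph V {x // x ≠ f} :=
      { src := fun x => D.src x.1
        tgt := fun x => if x.1 = e then D.tgt f else D.tgt x.1 }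
    have hrf : ∀ x, r x ≠ f := fun x h => hfr ⟨x, h⟩
    have hre : ∀ x, r x ≠ e := fun x h => her ⟨x, h⟩
    have hcard : Fintype.card {x // x ≠ f} ≤ m := by
      have := Fintype.card_subtype_lt (p := fun x => x ≠ f) (x := f) (by simp)
      omega
    obtain ⟨E', i', D', σ', r', h1, h2, h3, h4⟩ := ih {x // x ≠ f} hcard D₁
      (σ₂.subtypePerm (fun x => (hσ₂' x).symm)) (by
        rintro ⟨x, hx⟩
        show D.src (σ₂ x) = if x = e then D.tgt f else D.tgt x
        rw [hσ₂, Equiv.Perm.mul_apply]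
        split_ifs with hxe
        · rw [hxe, hσ₁e, Equiv.swap_apply_left, hsrc₁]
        · rw [Equiv.swap_apply_of_ne_of_ne, hsrc₁]
          · intro h; exact hxe (σ₁.injective (h.trans hσ₁e.symm))
          · intro h; exact hx (σ₁.injective h))
      (fun x => ⟨r x, hrf x⟩) (fun x => by
        show s(D.src (r x), if r x = e then D.tgt f else D.tgt (r x)) = x.1
        rw [if_neg (hre x), hr])
    refine ⟨E', i', D', σ', r', h1, h2, WalkImmerses.trans ?_ h3, h4⟩
    refine ⟨fun x => if x.1 = e then [e, f] else [x.1], ?_, ?_⟩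
    · rintro ⟨x, hx⟩
      show D.IsWalk (D.src x) (if x = e then [e, f] else [x])
        (if x = e then D.tgt f else D.tgt x)
      split_ifs with h
      · subst h
        exact ⟨rfl, by rw [he, hf], rfl⟩
      · exact isWalk_singleton x
    · rintro ⟨x, hx⟩ ⟨y, hy⟩ hxy
      have hxy' : x ≠ y := fun h => hxy (Subtype.ext h)
      show (if x = e then [e, f] else [x]).Disjoint (if y = e then [e, f] else [y])
      split_ifs with h h'
      · exact absurd (h.trans h'.symm) hxy'
      · simp only [List.disjoint_cons_left, List.mem_singleton, List.disjoint_nil_left, and_true]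
        exact ⟨fun h => h' h.symm, fun h => hy h.symm⟩
      · simp only [List.disjoint_cons_left, List.mem_cons, List.disjoint_nil_left, and_true,
          List.not_mem_nil, or_false, not_or]
        exact ⟨h, hx⟩
      · simpa using hxy'.symm

end Reduction

end MultiDigraph

/-! ### Dense sets without sparse balanced cuts. -/

namespace SimpleGraph

variable {V : Type*} [DecidableEq V]

theorem card_interedges_split (G : SimpleGraph V) [DecidableRel G.Adj] {S U : Finset V}
    (h : S ⊆ U) : (G.interedges U U).card = (G.interedges S S).card +
      (G.interedges (U \ S) (U \ S)).card + 2 * (G.interedges S (U \ S)).card := by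
  have hd : Disjoint S (U \ S) := Finset.disjoint_sdiff
  have hleft : ∀ T, (G.interedges U T).card =
      (G.interedges S T).card + (G.interedges (U \ S) T).card := fun T => by
    rw [← Finset.card_union_of_disjoint (G.interedges_disjoint_left hd T)]
    congr 1
    ext x
    have : x.1 ∈ U ↔ x.1 ∈ S ∨ x.1 ∈ U \ S := by
      rw [← Finset.mem_union, Finset.union_sdiff_of_subset h]
    simp only [mem_interedges_iff, Finset.mem_union, this]
    tauto
  have : Std.Symm G.Adj := ⟨fun _ _ h => h.symm⟩
  have hcomm : ∀ A B, (G.interedges A B).card = (G.interedges B A).card := fun A B =>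
    Rel.card_interedges_comm A B
  rw [hleft U, hcomm S U, hcomm (U \ S) U, hleft S, hleft (U \ S), hcomm (U \ S) S]
  ring

/-- A dense graph has a large vertex set that spans many edges and has no sparse balanced cut. -/
theorem exists_cut_dense_set [Fintype V] (G : SimpleGraph V) [DecidableRel G.Adj] {a κ ε : ℝ}
    [Nonempty V] (hκ₀ : 0 < κ) (hκ : κ ≤ 1)
    (hG : a * (Fintype.card V) ^ 2 ≤ (G.interedges Finset.univ Finset.univ).card)
    (hε : 0 ≤ ε) :
    ∃ U : Finset V, κ * Fintype.card V ≤ U.card ∧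
      a * Fintype.card V * U.card - 2 * ε * (Fintype.card V) ^ 2 ≤ (G.interedges U U).card ∧
      ∀ S ⊆ U, κ * Fintype.card V ≤ S.card → κ * Fintype.card V ≤ (U \ S).card →
        ε * (Fintype.card V) ^ 2 ≤ (G.interedges S (U \ S)).card := by
  classical
  set n : ℝ := (Fintype.card V : ℝ) with hn
  -- Take a smallest `U` in `P`. If a cut were sparse, both sides would be smaller and so violate
  -- the edge bound. Adding the two violations gives a deficit of more than `4 * ε * n ^ 2`, while
  -- the cut returns less than `2 * ε * n ^ 2`, contradicting the bound for `U`.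
  let P : Finset (Finset V) := Finset.univ.filter fun U => κ * n ≤ U.card ∧
      a * n * U.card - 2 * ε * n ^ 2 ≤ (G.interedges U U).card
  have hP : P.Nonempty := by
    refine ⟨Finset.univ, Finset.mem_filter.2 ⟨Finset.mem_univ _, ?_, ?_⟩⟩
    · rw [Finset.card_univ]
      exact mul_le_of_le_one_left (Nat.cast_nonneg _) hκ
    · rw [Finset.card_univ]
      have : 0 ≤ ε * n ^ 2 := by positivity
      nlinarith
  obtain ⟨U, hU, hmin⟩ := P.exists_min_image Finset.card hP
  obtain ⟨-, hU1, hU2⟩ := Finset.mem_filter.1 hU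
  refine ⟨U, hU1, hU2, fun S hS h1 h2 => ?_⟩
  by_contra! hlt
  have hκn : 0 < κ * n := mul_pos hκ₀ (Nat.cast_pos.2 Fintype.card_pos)
  have hne : 0 < S.card := by exact_mod_cast hκn.trans_le h1
  have hne' : 0 < (U \ S).card := by exact_mod_cast hκn.trans_le h2
  have hcard : S.card + (U \ S).card = U.card := by
    rw [add_comm]; exact Finset.card_sdiff_add_card_eq_card hS
  have hcardR : (S.card : ℝ) + (U \ S).card = U.card := by exact_mod_cast hcard
  have hsplit := G.card_interedges_split hS
  have hsplitR : ((G.interedges U U).card : ℝ) = (G.interedges S S).card +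
      (G.interedges (U \ S) (U \ S)).card + 2 * (G.interedges S (U \ S)).card := by
    exact_mod_cast hsplit
  have hSP : S ∉ P := fun h => by
    have := hmin S h
    omega
  have hTP : U \ S ∉ P := fun h => by
    have := hmin _ h
    omega
  have hS' : (G.interedges S S).card < a * n * S.card - 2 * ε * n ^ 2 := by
    by_contra! h
    exact hSP (Finset.mem_filter.2 ⟨Finset.mem_univ _, h1, h⟩)
  have hT' : (G.interedges (U \ S) (U \ S)).card < a * n * (U \ S).card - 2 * ε * n ^ 2 := by
    by_contra! h
    exact hTP (Finset.mem_filter.2 ⟨Finset.mem_univ _, h2, h⟩)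
  rw [← hcardR] at hU2
  nlinarith

end SimpleGraph
namespace MultiDigraph

/-! ### Short walks, greedy linking and return walks. -/

section Routing

variable {V E : Type*} {D : MultiDigraph V E}

/-- Since `σ` matches edges ending in `S` with edges starting in `S`, removing the edges inside `S`
from both leaves equal numbers. -/
theorem card_cut_eq [DecidableEq V] [Fintype E]
    (σ : Equiv.Perm E) (hσ : ∀ e, D.src (σ e) = D.tgt e) (S : Finset V) :
    (Finset.univ.filter fun e => D.src e ∈ S ∧ D.tgt e ∉ S).card =
      (Finset.univ.filter fun e => D.src e ∉ S ∧ D.tgt e ∈ S).card := by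
  have h : (Finset.univ.filter fun e => D.tgt e ∈ S).card =
      (Finset.univ.filter fun e => D.src e ∈ S).card :=
    Finset.card_equiv σ fun e => by simp [hσ]
  have h1 := Finset.card_filter_add_card_filter_not
    (s := Finset.univ.filter fun e => D.tgt e ∈ S) (fun e => D.src e ∈ S)
  have h2 := Finset.card_filter_add_card_filter_not
    (s := Finset.univ.filter fun e => D.src e ∈ S) (fun e => D.tgt e ∈ S)
  simp only [Finset.filter_filter] at h1 h2
  have h3 : ∀ e, (D.tgt e ∈ S ∧ D.src e ∈ S) = (D.src e ∈ S ∧ D.tgt e ∈ S) :=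
    fun e => propext and_comm
  have h4 : ∀ e, (D.tgt e ∈ S ∧ D.src e ∉ S) = (D.src e ∉ S ∧ D.tgt e ∈ S) :=
    fun e => propext and_comm
  simp only [h3, h4] at h1
  omega

/-- If every set separating `X` from `X'` sends out many edges outside `bad`, then breadth-first
search finds a short walk from `X` to `X'` avoiding `bad`. -/
theorem exists_short_walk [Fintype V] [DecidableEq V] [Fintype E] [DecidableEq E]
    {K : ℕ} {N δ : ℝ} (hN : 0 < N) (bad : Finset E) (X X' : Finset V)
    (hin : ∀ v, ((Finset.univ.filter fun e => D.tgt e = v).card : ℝ) ≤ N)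
    (hcut : ∀ S : Finset V, X ⊆ S → Disjoint S X' → δ * N ≤
      (Finset.univ.filter fun e => (D.src e ∈ S ∧ D.tgt e ∉ S) ∧ e ∉ bad).card)
    (hK : (Fintype.card V : ℝ) < K * δ) :
    ∃ x ∈ X, ∃ y ∈ X', ∃ p, D.IsWalk x p y ∧ (∀ e ∈ p, e ∉ bad) ∧ p.length ≤ K := by
  classical
  let reach : ℕ → Finset V := fun k => Finset.univ.filter fun v =>
    ∃ x ∈ X, ∃ p, D.IsWalk x p v ∧ (∀ e ∈ p, e ∉ bad) ∧ p.length ≤ k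
  by_contra! hcon
  have hdisj : ∀ k ≤ K, Disjoint (reach k) X' := by
    intro k hk
    rw [Finset.disjoint_left]
    intro y hy hy'
    obtain ⟨x, hx, p, hp, hb, hl⟩ := (Finset.mem_filter.1 hy).2
    have := hcon x hx y hy' p hp hb
    omega
  have hX : ∀ k, X ⊆ reach k := fun k x hx => Finset.mem_filter.2
    ⟨Finset.mem_univ _, x, hx, [], rfl, by simp, Nat.zero_le _⟩
  -- Each layer is left by at least `δ * N` good edges, and at most `N` of them share a head, so
  -- each step gains at least `δ` vertices. After `K` steps there would be more vertices than `V`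
  -- has.
  have hgrow : ∀ k ≤ K, k * δ ≤ (reach k).card := by
    intro k
    induction k with
    | zero => intro _; simp
    | succ k ih =>
      intro hk
      have h1 := ih (by omega)
      set A := Finset.univ.filter fun e => (D.src e ∈ reach k ∧ D.tgt e ∉ reach k) ∧ e ∉ bad
        with hA
      have h2 : δ * N ≤ A.card := hcut _ (hX k) (hdisj k (by omega))
      have h3 : A.image D.tgt ⊆ reach (k + 1) \ reach k := by
        intro v hv
        obtain ⟨e, he, rfl⟩ := Finset.mem_image.1 hv
        obtain ⟨-, ⟨h4, h5⟩, h6⟩ := Finset.mem_filter.1 he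
        refine Finset.mem_sdiff.2 ⟨?_, h5⟩
        obtain ⟨-, x, hx, p, hp, hb, hl⟩ := Finset.mem_filter.1 h4
        refine Finset.mem_filter.2 ⟨Finset.mem_univ _, x, hx, p ++ [e],
          hp.append (isWalk_singleton e), ?_, by simpa using hl⟩
        intro e' he'
        rcases List.mem_append.1 he' with h | h
        · exact hb _ h
        · rw [List.mem_singleton.1 h]; exact h6
      have h4 : (A.card : ℝ) ≤ N * (A.image D.tgt).card := by
        rw [Finset.card_eq_sum_card_image D.tgt A, Nat.cast_sum, mul_comm]
        rw [← nsmul_eq_mul]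
        refine Finset.sum_le_card_nsmul _ _ _ fun v _ => le_trans ?_ (hin v)
        exact_mod_cast Finset.card_le_card (Finset.filter_subset_filter _ (Finset.subset_univ _))
      have h5 : reach k ⊆ reach (k + 1) := fun v hv => by
        obtain ⟨-, x, hx, p, hp, hb, hl⟩ := Finset.mem_filter.1 hv
        exact Finset.mem_filter.2 ⟨Finset.mem_univ _, x, hx, p, hp, hb, by omega⟩
      have h6 : (reach k).card + (A.image D.tgt).card ≤ (reach (k + 1)).card := by
        rw [← Finset.card_sdiff_add_card_eq_card h5, add_comm]
        exact Nat.add_le_add_right (Finset.card_le_card h3) _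
      have h7 : δ ≤ (A.image D.tgt).card := by
        refine le_of_mul_le_mul_right ?_ hN
        linarith
      have h8 : ((reach k).card : ℝ) + (A.image D.tgt).card ≤ (reach (k + 1)).card := by
        exact_mod_cast h6
      push_cast
      linarith
  have h1 := hgrow K le_rfl
  have h2 : ((reach K).card : ℝ) ≤ Fintype.card V := by exact_mod_cast Finset.card_le_univ _
  linarith

/-- If short walks between large sets exist outside every small edge set, then prescribed pairs
with many edges of `Fo` and `Fi` at their ends can be linked greedily. -/
theorem exists_disjoint_connections [DecidableEq V] [Nonempty E] {ι : Type*} [Fintype ι]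
    (u v : ι → V) (Fo Fi bad : Finset E) (U : Finset V) {K M m : ℕ}
    (hroute : ∀ (B : Finset E) (X X' : Finset V), B.card ≤ M → X ⊆ U → X' ⊆ U → m ≤ X.card →
      m ≤ X'.card → ∃ x ∈ X, ∃ y ∈ X', ∃ p, D.IsWalk x p y ∧ (∀ e ∈ p, e ∉ B) ∧ p.length ≤ K)
    (hM : bad.card + Fintype.card ι * K ≤ M)
    (hFo : ∀ e ∈ Fo, D.tgt e ∈ U) (hFi : ∀ e ∈ Fi, D.src e ∈ U)
    (hFo' : ∀ k, Set.InjOn D.tgt {e | e ∈ Fo ∧ D.src e = u k})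
    (hFi' : ∀ k, Set.InjOn D.src {e | e ∈ Fi ∧ D.tgt e = v k})
    (hu : ∀ k, m + (Finset.univ.filter fun k' => u k' = u k).card ≤
      (Fo.filter fun e => D.src e = u k).card)
    (hv : ∀ k, m + (Finset.univ.filter fun k' => v k' = v k).card ≤
      (Fi.filter fun e => D.tgt e = v k).card) :
    ∃ (a z : ι → E) (p : ι → List E), Function.Injective a ∧ Function.Injective z ∧
      Pairwise (fun k k' => (p k).Disjoint (p k')) ∧
      ∀ k, a k ∈ Fo ∧ D.src (a k) = u k ∧ z k ∈ Fi ∧ D.tgt (z k) = v k ∧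
        D.IsWalk (D.tgt (a k)) (p k) (D.src (z k)) ∧ ∀ e ∈ p k, e ∉ bad := by
  classical
  have key : ∀ A : Finset ι, ∃ (a z : ι → E) (p : ι → List E), Set.InjOn a A ∧ Set.InjOn z A ∧
      (∀ k ∈ A, ∀ k' ∈ A, k ≠ k' → (p k).Disjoint (p k')) ∧
      ∀ k ∈ A, a k ∈ Fo ∧ D.src (a k) = u k ∧ z k ∈ Fi ∧ D.tgt (z k) = v k ∧
        D.IsWalk (D.tgt (a k)) (p k) (D.src (z k)) ∧ (∀ e ∈ p k, e ∉ bad) ∧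
        (p k).length ≤ K := by
    intro A
    induction A using Finset.induction_on with
    | empty =>
      obtain ⟨e⟩ := ‹Nonempty E›
      exact ⟨fun _ => e, fun _ => e, fun _ => [], by simp, by simp, by simp, by simp⟩
    | insert k A hk ih =>
      obtain ⟨a, z, p, ha, hz, hp, h⟩ := ih
      set B := bad ∪ A.biUnion fun k => (p k).toFinset with hB
      have hBcard : B.card ≤ M := by
        refine le_trans ((Finset.card_union_le _ _).trans (Nat.add_le_add_left ?_ _)) hM
        refine (Finset.card_biUnion_le_card_mul _ _ K fun k' hk' => ?_).trans
          (Nat.mul_le_mul_right _ (Finset.card_le_univ _))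
        exact (List.toFinset_card_le _).trans (h k' hk').2.2.2.2.2.2
      -- Only earlier pairs with the same end vertex can have used edges at it, so `m` edges there
      -- are still free. Their other ends are distinct by `hFo'` and `hFi'`, so they form sets large
      -- enough for `hroute`.
      have free : ∀ (F : Finset E) (g : E → V) (w : ι → V) (t : ι → E),
          m + (Finset.univ.filter fun k' => w k' = w k).card ≤
            (F.filter fun e => g e = w k).card →
          m ≤ ((F.filter fun e => g e = w k) \ (A.filter fun k' => w k' = w k).image t).card := by
        intro F g w t hF
        have h1 := Finset.le_card_sdiff ((A.filter fun k' => w k' = w k).image t)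
          (F.filter fun e => g e = w k)
        have h2 : ((A.filter fun k' => w k' = w k).image t).card ≤
            (Finset.univ.filter fun k' => w k' = w k).card :=
          Finset.card_image_le.trans
            (Finset.card_le_card (Finset.filter_subset_filter _ (Finset.subset_univ _)))
        omega
      set X₀ := (Fo.filter fun e => D.src e = u k) \ (A.filter fun k' => u k' = u k).image a
        with hX₀
      set Z₀ := (Fi.filter fun e => D.tgt e = v k) \ (A.filter fun k' => v k' = v k).image z
        with hZ₀
      have hX₀c : m ≤ X₀.card := free Fo D.src u a (hu k)
      have hZ₀c : m ≤ Z₀.card := free Fi D.tgt v z (hv k)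
      have hX₀m : ∀ e ∈ X₀, e ∈ Fo ∧ D.src e = u k ∧ ∀ k' ∈ A, a k' ≠ e := by
        intro e he
        obtain ⟨h1, h2⟩ := Finset.mem_sdiff.1 he
        obtain ⟨h3, h4⟩ := Finset.mem_filter.1 h1
        refine ⟨h3, h4, fun k' hk' hke => h2 (Finset.mem_image.2 ⟨k', ?_, hke⟩)⟩
        exact Finset.mem_filter.2 ⟨hk', by rw [← (h k' hk').2.1, hke, h4]⟩
      have hZ₀m : ∀ e ∈ Z₀, e ∈ Fi ∧ D.tgt e = v k ∧ ∀ k' ∈ A, z k' ≠ e := by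
        intro e he
        obtain ⟨h1, h2⟩ := Finset.mem_sdiff.1 he
        obtain ⟨h3, h4⟩ := Finset.mem_filter.1 h1
        refine ⟨h3, h4, fun k' hk' hke => h2 (Finset.mem_image.2 ⟨k', ?_, hke⟩)⟩
        exact Finset.mem_filter.2 ⟨hk', by rw [← (h k' hk').2.2.2.1, hke, h4]⟩
      have hX₁ : (X₀.image D.tgt).card = X₀.card := Finset.card_image_of_injOn
        fun e he e' he' => hFo' k ⟨(hX₀m e he).1, (hX₀m e he).2.1⟩
          ⟨(hX₀m e' he').1, (hX₀m e' he').2.1⟩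
      have hZ₁ : (Z₀.image D.src).card = Z₀.card := Finset.card_image_of_injOn
        fun e he e' he' => hFi' k ⟨(hZ₀m e he).1, (hZ₀m e he).2.1⟩
          ⟨(hZ₀m e' he').1, (hZ₀m e' he').2.1⟩
      obtain ⟨x, hx, y, hy, q, hq, hqB, hqK⟩ := hroute B (X₀.image D.tgt) (Z₀.image D.src) hBcard
        (Finset.image_subset_iff.2 fun e he => hFo e (hX₀m e he).1)
        (Finset.image_subset_iff.2 fun e he => hFi e (hZ₀m e he).1)
        (hX₁ ▸ hX₀c) (hZ₁ ▸ hZ₀c)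
      obtain ⟨a', ha', rfl⟩ := Finset.mem_image.1 hx
      obtain ⟨z', hz', rfl⟩ := Finset.mem_image.1 hy
      have hne : ∀ k' ∈ A, k' ≠ k := fun k' hk' h => hk (h ▸ hk')
      have hqA : ∀ k' ∈ A, q.Disjoint (p k') := fun k' hk' e he he' => hqB e he
        (Finset.mem_union_right _ (Finset.mem_biUnion.2 ⟨k', hk', List.mem_toFinset.2 he'⟩))
      refine ⟨Function.update a k a', Function.update z k z', Function.update p k q, ?_, ?_, ?_, ?_⟩
      · rw [Finset.coe_insert, Set.injOn_insert (by simpa using hk)]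
        refine ⟨fun i hi j hj hij => ha hi hj ?_, ?_⟩
        · rwa [Function.update_of_ne (hne i hi), Function.update_of_ne (hne j hj)] at hij
        · rintro ⟨i, hi, hia⟩
          rw [Function.update_of_ne (hne i hi), Function.update_self] at hia
          exact (hX₀m a' ha').2.2 i hi hia
      · rw [Finset.coe_insert, Set.injOn_insert (by simpa using hk)]
        refine ⟨fun i hi j hj hij => hz hi hj ?_, ?_⟩
        · rwa [Function.update_of_ne (hne i hi), Function.update_of_ne (hne j hj)] at hij
        · rintro ⟨i, hi, hia⟩
          rw [Function.update_of_ne (hne i hi), Function.update_self] at hia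
          exact (hZ₀m z' hz').2.2 i hi hia
      · intro i hi j hj hij
        rcases Finset.mem_insert.1 hi with rfl | hiA
        · have hj := (Finset.mem_insert.1 hj).resolve_left hij.symm
          rw [Function.update_self, Function.update_of_ne hij.symm]
          exact hqA j hj
        · rw [Function.update_of_ne (hne i hiA)]
          rcases Finset.mem_insert.1 hj with rfl | hjA
          · rw [Function.update_self]; exact (hqA i hiA).symm
          · rw [Function.update_of_ne (hne j hjA)]; exact hp i hiA j hjA hij
      · intro i hi
        rcases Finset.mem_insert.1 hi with rfl | hi
        · simp only [Function.update_self]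
          exact ⟨(hX₀m a' ha').1, (hX₀m a' ha').2.1, (hZ₀m z' hz').1, (hZ₀m z' hz').2.1, hq,
            fun e he heb => hqB e he (Finset.mem_union_left _ heb), hqK⟩
        · simp only [Function.update_of_ne (hne i hi)]
          exact h i hi
  obtain ⟨a, z, p, ha, hz, hp, h⟩ := key Finset.univ
  refine ⟨a, z, p, fun i j hij => ha (by simp) (by simp) hij,
    fun i j hij => hz (by simp) (by simp) hij,
    fun i j hij => hp i (Finset.mem_univ _) j (Finset.mem_univ _) hij, fun k => ?_⟩
  obtain ⟨h1, h2, h3, h4, h5, h6, -⟩ := h k (Finset.mem_univ _)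
  exact ⟨h1, h2, h3, h4, h5, h6⟩

theorem isWalk_orbit (σ : Equiv.Perm E) (hσ : ∀ e, D.src (σ e) = D.tgt e) (e : E) (m : ℕ) :
    D.IsWalk (D.tgt e) ((List.range m).map fun i => (σ ^ (i + 1)) e)
      (D.src ((σ ^ (m + 1)) e)) := by
  induction m with
  | zero => exact (by simp [hσ] : D.tgt e = D.src ((σ ^ (0 + 1)) e))
  | succ m ih =>
    rw [List.range_succ, List.map_append]
    refine ih.append ?_
    rw [pow_succ' σ (m + 1), Equiv.Perm.mul_apply, hσ]
    exact isWalk_singleton _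

/-- Following the closed trails of an Eulerian digraph from an edge of `F` to the next one gives
pairwise edge-disjoint walks. -/
theorem exists_returns [Fintype E] (σ : Equiv.Perm E) (hσ : ∀ e, D.src (σ e) = D.tgt e)
    (F : Finset E) :
    ∃ (ret : E → List E) (τ : E → E),
      (∀ f ∈ F, τ f ∈ F ∧ D.IsWalk (D.tgt f) (ret f) (D.src (τ f)) ∧ ∀ e ∈ ret f, e ∉ F) ∧
      Set.InjOn τ F ∧ (∀ f ∈ F, ∀ g ∈ F, f ≠ g → (ret f).Disjoint (ret g)) ∧
      ∑ f ∈ F, (ret f).length ≤ Fintype.card E := by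
  classical
  have hex : ∀ f ∈ F, ∃ k, (σ ^ (k + 1)) f ∈ F ∧ ∀ i < k, (σ ^ (i + 1)) f ∉ F := by
    intro f hf
    have h : ∃ k, (σ ^ (k + 1)) f ∈ F := by
      refine ⟨orderOf σ - 1, ?_⟩
      rw [Nat.sub_add_cancel (orderOf_pos σ), pow_orderOf_eq_one]
      exact hf
    exact ⟨Nat.find h, Nat.find_spec h, fun i hi => Nat.find_min h hi⟩
  choose! k hk hmin using hex
  -- If two orbits meet, cancelling powers of `σ` puts `f` on the orbit of `g` no later than the
  -- first return to `F`. Minimality of `k g` forces the shift to be zero.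
  have key' : ∀ f ∈ F, ∀ g ∈ F, ∀ i j, i ≤ j → j ≤ k g →
      (σ ^ (i + 1)) f = (σ ^ (j + 1)) g → f = g ∧ i = j := by
    intro f hf g hg i j hij hj h
    obtain ⟨t, rfl⟩ := Nat.exists_eq_add_of_le hij
    rw [show i + t + 1 = (i + 1) + t by ring, pow_add σ (i + 1) t, Equiv.Perm.mul_apply] at h
    have h' : f = (σ ^ t) g := (σ ^ (i + 1)).injective h
    cases t with
    | zero => exact ⟨by simpa using h', rfl⟩
    | succ t => exact absurd (h' ▸ hf) (hmin g hg t (by omega))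
  have key : ∀ f ∈ F, ∀ g ∈ F, ∀ i j, i ≤ k f → j ≤ k g →
      (σ ^ (i + 1)) f = (σ ^ (j + 1)) g → f = g ∧ i = j := by
    intro f hf g hg i j hi hj h
    rcases le_total i j with hij | hij
    · exact key' f hf g hg i j hij hj h
    · obtain ⟨h1, h2⟩ := key' g hg f hf j i hij hi h.symm
      exact ⟨h1.symm, h2.symm⟩
  have hmem : ∀ f e, e ∈ (List.range (k f)).map (fun i => (σ ^ (i + 1)) f) →
      ∃ i < k f, (σ ^ (i + 1)) f = e := fun f e he => by simpa using he
  have hdisj : ∀ f ∈ F, ∀ g ∈ F, f ≠ g →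
      ((List.range (k f)).map fun i => (σ ^ (i + 1)) f).Disjoint
        ((List.range (k g)).map fun i => (σ ^ (i + 1)) g) := by
    intro f hf g hg hfg e he he'
    obtain ⟨i, hi, rfl⟩ := hmem f e he
    obtain ⟨j, hj, h⟩ := hmem g _ he'
    exact hfg (key f hf g hg i j hi.le hj.le h.symm).1
  refine ⟨fun f => (List.range (k f)).map fun i => (σ ^ (i + 1)) f,
    fun f => (σ ^ (k f + 1)) f, fun f hf => ⟨hk f hf, isWalk_orbit σ hσ f (k f), ?_⟩, ?_,
    hdisj, ?_⟩
  · intro e he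
    obtain ⟨i, hi, rfl⟩ := hmem f e he
    exact hmin f hf i hi
  · intro f hf g hg h
    exact (key f hf g hg _ _ le_rfl le_rfl h).1
  · have hnd : ∀ f ∈ F, ((List.range (k f)).map fun i => (σ ^ (i + 1)) f).Nodup := by
      intro f hf
      refine List.Nodup.map_on ?_ List.nodup_range
      intro i hi j hj h
      exact (key f hf f hf i j (List.mem_range.1 hi).le (List.mem_range.1 hj).le h).2
    rw [← Finset.sum_congr rfl fun f hf => List.toFinset_card_of_nodup (hnd f hf),
      ← Finset.card_biUnion]
    · exact Finset.card_le_univ _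
    · intro f hf g hg hfg
      exact List.disjoint_toFinset_iff_disjoint.2 (hdisj f hf g hg hfg)

/-- Averaging: a fibre of size at least `t` contributes at most `N`, any other at most `t`. -/
theorem card_le_card_large_fibers {α β : Type*} [DecidableEq β] (A : Finset α) (g : α → β)
    (U : Finset β) (hg : ∀ e ∈ A, g e ∈ U) {N t : ℝ} (ht : 0 ≤ t)
    (hN : ∀ v, ((A.filter fun e => g e = v).card : ℝ) ≤ N) :
    (A.card : ℝ) ≤ N * (U.filter fun v => t ≤ (A.filter fun e => g e = v).card).card
      + t * U.card := by
  rw [Finset.card_eq_sum_card_fiberwise hg, Nat.cast_sum]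
  calc ∑ v ∈ U, ((A.filter fun e => g e = v).card : ℝ)
      ≤ ∑ v ∈ U, ((if t ≤ (A.filter fun e => g e = v).card then N else 0) + t) := by
        refine Finset.sum_le_sum fun v _ => ?_
        split_ifs with h
        · linarith [hN v]
        · linarith
    _ = _ := by
        rw [Finset.sum_add_distrib, ← Finset.sum_filter, Finset.sum_const, Finset.sum_const,
          nsmul_eq_mul, nsmul_eq_mul]
        ring

end Routing

end MultiDigraph
namespace MultiDigraph

/-! ### Choosing the branch vertices by double counting. -/

section Terminals

variable {V E : Type*} {D : MultiDigraph V E}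

theorem exists_injective_mem_of_le_card {α : Type*} {s : ℕ} {A : Finset α} (h : s ≤ A.card) :
    ∃ f : Fin s → α, Function.Injective f ∧ ∀ i, f i ∈ A := by
  obtain ⟨B, hBA, hB⟩ := Finset.exists_subset_card_eq h
  refine ⟨fun i => ((Finset.equivFinOfCardEq hB).symm i).1, fun i j hij => ?_,
    fun i => hBA ((Finset.equivFinOfCardEq hB).symm i).2⟩
  exact (Finset.equivFinOfCardEq hB).symm.injective (Subtype.ext hij)

/-- A choice of branch vertices `b j`, together with `s` short return walks to each of them, all
starting in a small set `Y` of vertices of large in-degree. -/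
theorem exists_terminals [Fintype V] [Fintype E] [DecidableEq V] [DecidableEq E] {c : ℝ} {s : ℕ}
    (hc : 0 < c) (hc1 : c ≤ 1)
    (hs1 : 1 ≤ s) (hs : (s : ℝ) ≤ 4 / 10 ^ 8 * c ^ 4 * Fintype.card V)
    (F : Finset E) (U : Finset V) (hFU : ∀ e ∈ F, D.tgt e ∈ U)
    (hU : c / 64 * Fintype.card V ≤ U.card)
    (hin : ∀ v, ((Finset.univ.filter fun e => D.tgt e = v).card : ℝ) ≤ Fintype.card V)
    (hout : ∀ v, ((Finset.univ.filter fun e => D.src e = v).card : ℝ) ≤ Fintype.card V)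
    (hE : (Fintype.card E : ℝ) ≤ Fintype.card V * U.card)
    (hF : c * Fintype.card V * U.card / 4 ≤ F.card)
    (ret : E → List E) (τ : E → E) (hτ : Set.InjOn τ F)
    (hret : ∑ f ∈ F, (ret f).length ≤ Fintype.card E) :
    ∃ (b : Fin s → V) (f : Fin s × Fin s → E) (Y : Finset V), Function.Injective b ∧
      Function.Injective f ∧
      (∀ k, f k ∈ F ∧ ((ret (f k)).length : ℝ) ≤ 8 / c ∧ D.src (τ (f k)) = b k.2 ∧
        D.tgt (f k) ∈ Y) ∧
      (Y.card : ℝ) ≤ 128 * s / c + 1 ∧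
      (∀ k, ((Finset.univ.filter fun k' => D.tgt (f k') = D.tgt (f k)).card : ℝ) ≤
        c * Fintype.card V / 32) ∧
      ∀ k, c * Fintype.card V / 16 ≤ (F.filter fun e => D.tgt e = D.tgt (f k)).card := by
  classical
  set n : ℝ := (Fintype.card V : ℝ) with hn
  have hs1' : (1 : ℝ) ≤ s := by exact_mod_cast hs1
  have hn0 : 0 < n := by
    by_contra! h
    have : 4 / 10 ^ 8 * c ^ 4 * n ≤ 0 := mul_nonpos_of_nonneg_of_nonpos (by positivity) h
    linarith
  have hcn : c ^ 4 * n ≤ c * n :=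
    mul_le_mul_of_nonneg_right (pow_le_of_le_one hc.le hc1 (by norm_num)) hn0.le
  have hcn2 : c ^ 4 * n ≤ c ^ 2 * n :=
    mul_le_mul_of_nonneg_right (pow_le_pow_of_le_one hc.le hc1 (by norm_num)) hn0.le
  have hcn3 : c ^ 3 * n ≤ c ^ 2 * n :=
    mul_le_mul_of_nonneg_right (pow_le_pow_of_le_one hc.le hc1 (by norm_num)) hn0.le
  -- the edges of `F` with a short return walk
  set short := F.filter fun f => ((ret f).length : ℝ) ≤ 8 / c with hshort
  -- Return walks longer than `8 / c` number at most `c * n * U.card / 8`, as the total length is at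
  -- most `n * U.card`. That is half of the lower bound on `F.card`.
  have hshort_card : c * n * U.card / 8 ≤ short.card := by
    have h1 : ((F.filter fun f => ¬ ((ret f).length : ℝ) ≤ 8 / c).card : ℝ) * (8 / c) ≤
        n * U.card := by
      refine le_trans ?_ hE
      refine le_trans ?_ (Nat.cast_le.2 hret)
      rw [Nat.cast_sum, ← nsmul_eq_mul]
      refine le_trans (Finset.card_nsmul_le_sum _ (fun f => ((ret f).length : ℝ)) _ ?_)
        (Finset.sum_le_sum_of_subset_of_nonneg (Finset.filter_subset _ _) ?_)
      · intro f hf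
        exact (not_le.1 (Finset.mem_filter.1 hf).2).le
      · intros; positivity
    have h2 : (short.card : ℝ) + (F.filter fun f => ¬ ((ret f).length : ℝ) ≤ 8 / c).card =
        F.card := by
      exact_mod_cast Finset.card_filter_add_card_filter_not _
    rw [mul_div_assoc', div_le_iff₀ hc] at h1
    linarith
  have hfib : ∀ {A : Finset E} (v : V),
      ((A.filter fun e => D.tgt e = v).card : ℝ) ≤ n := fun v =>
    le_trans (Nat.cast_le.2 (Finset.card_le_card
      (Finset.filter_subset_filter _ (Finset.subset_univ _)))) (hin v)
  -- vertices where many of these end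
  set Yg := U.filter fun y => c * n / 16 ≤ (short.filter fun e => D.tgt e = y).card with hYg
  have hYg_card : c ^ 2 * n / 1024 ≤ Yg.card := by
    have h1 := card_le_card_large_fibers short D.tgt U
      (fun e he => hFU e (Finset.mem_filter.1 he).1) (N := n) (t := c * n / 16)
      (by positivity) hfib
    rw [← hYg] at h1
    have h2 : c * U.card / 16 ≤ (Yg.card : ℝ) := by
      refine le_of_mul_le_mul_left ?_ hn0
      linarith
    have h3 : c * (c / 64 * n) ≤ c * U.card := mul_le_mul_of_nonneg_left hU hc.le
    linarith
  -- Taking `h` edges at each of `q` vertices gives `q * h ≥ 2 * s * n`, enough for the averaging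
  -- below. Keeping `h` at most half of `c * n / 16` leaves incoming edges of `F` for the links into
  -- `Y`.
  set q := ⌈128 * (s : ℝ) / c⌉₊ with hq
  set h := ⌊c * n / 32⌋₊ with hh
  have hq1 : 128 * (s : ℝ) / c ≤ q := Nat.le_ceil _
  have hq2 : (q : ℝ) < 128 * (s : ℝ) / c + 1 := Nat.ceil_lt_add_one (by positivity)
  have hh1 : (h : ℝ) ≤ c * n / 32 := Nat.floor_le (by positivity)
  have hh2 : c * n / 64 ≤ h := by
    have := Nat.lt_floor_add_one (c * n / 32)
    rw [← hh] at this
    linarith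
  have hqY : q ≤ Yg.card := by
    have h1 : 128 * (s : ℝ) / c ≤ 128 * (4 / 10 ^ 8 * c ^ 3 * n) := by
      rw [div_le_iff₀ hc]
      linarith
    have : (q : ℝ) ≤ Yg.card := by linarith
    exact_mod_cast this
  obtain ⟨Y, hYYg, hYq⟩ := Finset.exists_subset_card_eq hqY
  have hYs : ∀ y ∈ Y, c * n / 16 ≤ (short.filter fun e => D.tgt e = y).card :=
    fun y hy => (Finset.mem_filter.1 (hYYg hy)).2
  have hHex : ∀ y ∈ Y, ∃ H ⊆ short.filter (fun e => D.tgt e = y), H.card = h := by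
    intro y hy
    refine Finset.exists_subset_card_eq ?_
    have : (h : ℝ) ≤ (short.filter fun e => D.tgt e = y).card := by
      have := hYs y hy
      have : 0 ≤ c * n := by positivity
      linarith
    exact_mod_cast this
  choose! Hy hHy hHyc using hHex
  have hHy' : ∀ y ∈ Y, ∀ e ∈ Hy y, e ∈ short ∧ D.tgt e = y := fun y hy e he =>
    Finset.mem_filter.1 (hHy y hy he)
  set H := Y.biUnion Hy with hH
  have hHmem : ∀ e ∈ H, e ∈ short ∧ D.tgt e ∈ Y ∧ e ∈ Hy (D.tgt e) := by
    intro e he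
    obtain ⟨y, hy, hey⟩ := Finset.mem_biUnion.1 he
    obtain ⟨h1, h2⟩ := hHy' y hy e hey
    rw [h2]
    exact ⟨h1, hy, hey⟩
  have hHF : ∀ e ∈ H, e ∈ F := fun e he => (Finset.mem_filter.1 (hHmem e he).1).1
  have hHcard : H.card = q * h := by
    rw [hH, Finset.card_biUnion, Finset.sum_congr rfl hHyc, Finset.sum_const, hYq, smul_eq_mul]
    intro y hy y' hy' hne
    refine Finset.disjoint_left.2 ?_
    intro e he he'
    exact hne ((hHy' y hy e he).2.symm.trans (hHy' y' hy' e he').2)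
  -- As `τ` is injective, at most `n` edges of `H` return to any given vertex. Vertices receiving
  -- fewer than `s` account for at most `s * n` of the `2 * s * n` edges, so at least `s` vertices
  -- receive `s` or more.
  have hB := card_le_card_large_fibers H (fun e => D.src (τ e)) Finset.univ
    (fun _ _ => Finset.mem_univ _) (N := n) (t := s) (by positivity) (by
      intro v
      refine le_trans ?_ (hout v)
      rw [Nat.cast_le]
      refine Finset.card_le_card_of_injOn τ ?_ ?_
      · intro e he
        simp only [Finset.coe_filter, Set.mem_ofPred_eq] at he ⊢
        exact ⟨Finset.mem_univ _, he.2⟩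
      · intro e he e' he' hee
        simp only [Finset.coe_filter, Set.mem_ofPred_eq] at he he'
        exact hτ (hHF e he.1) (hHF e' he'.1) hee)
  set B := Finset.univ.filter fun v => (s : ℝ) ≤ (H.filter fun e => D.src (τ e) = v).card
    with hBdef
  have hBs : s ≤ B.card := by
    rw [Finset.card_univ, hHcard, Nat.cast_mul, ← hn] at hB
    have h1 : 128 * (s : ℝ) / c * (c * n / 64) ≤ q * h :=
      mul_le_mul hq1 hh2 (by positivity) (by positivity)
    have h2 : 128 * (s : ℝ) / c * (c * n / 64) = 2 * s * n := by
      field_simp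
      ring
    have h3 : (s : ℝ) ≤ B.card := by
      refine le_of_mul_le_mul_left ?_ hn0
      linarith
    exact_mod_cast h3
  obtain ⟨b, hbinj, hbB⟩ := exists_injective_mem_of_le_card hBs
  have hf : ∀ j, ∃ f : Fin s → E, Function.Injective f ∧
      ∀ i, f i ∈ H.filter fun e => D.src (τ e) = b j := fun j =>
    exists_injective_mem_of_le_card (by exact_mod_cast (Finset.mem_filter.1 (hbB j)).2)
  choose f hfinj hfmem using hf
  have hfH : ∀ i j, f j i ∈ H := fun i j => (Finset.mem_filter.1 (hfmem j i)).1
  have hfb : ∀ i j, D.src (τ (f j i)) = b j := fun i j => (Finset.mem_filter.1 (hfmem j i)).2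
  have hginj : Function.Injective fun k : Fin s × Fin s => f k.2 k.1 := by
    rintro ⟨i, j⟩ ⟨i', j'⟩ hk
    obtain rfl : j = j' := hbinj (by rw [← hfb i j, ← hfb i' j']; exact congrArg _ (congrArg τ hk))
    exact Prod.ext (hfinj j hk) rfl
  refine ⟨b, fun k => f k.2 k.1, Y, hbinj, hginj, fun k => ⟨hHF _ (hfH _ _), ?_, hfb _ _, ?_⟩,
    ?_, fun k => ?_, fun k => ?_⟩
  · exact (Finset.mem_filter.1 (hHmem _ (hfH k.1 k.2)).1).2
  · exact (hHmem _ (hfH k.1 k.2)).2.1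
  · rw [hYq]; exact hq2.le
  · refine le_trans ?_ hh1
    rw [Nat.cast_le, ← hHyc _ (hHmem _ (hfH k.1 k.2)).2.1]
    refine Finset.card_le_card_of_injOn (fun k => f k.2 k.1) ?_ hginj.injOn
    intro k' hk'
    have hk'' : D.tgt (f k'.2 k'.1) = D.tgt (f k.2 k.1) := by simpa using hk'
    have := (hHmem _ (hfH k'.1 k'.2)).2.2
    rw [hk''] at this
    exact this
  · refine (hYs _ (hHmem _ (hfH k.1 k.2)).2.1).trans ?_
    rw [Nat.cast_le]
    exact Finset.card_le_card (Finset.filter_subset_filter _ (Finset.filter_subset _ _))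

end Terminals

/-! ### Assembling the linking walks. -/

section Core

variable {V E : Type*} {D : MultiDigraph V E}

/-- The walk for `k = (i, j)` leaves `b i` by an edge of `F`, takes a short connection inside the
well-linked part, enters `Y` by an edge of `F` at the head of `f k`, and follows the return walk of
`f k` to `b j`. Diagonal pairs are included for uniformity. -/
theorem exists_linked_vertices [Fintype V] [Fintype E] [DecidableEq V] [DecidableEq E] {c : ℝ}
    {s : ℕ} (hc : 0 < c) (hc1 : c ≤ 1)
    (hs1 : 1 ≤ s) (hs : (s : ℝ) ≤ 4 / 10 ^ 8 * c ^ 4 * Fintype.card V)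
    (σ : Equiv.Perm E) (hσ : ∀ e, D.src (σ e) = D.tgt e)
    (R : Finset E) (U : Finset V) (hRU : ∀ e ∈ R, D.src e ∈ U ∧ D.tgt e ∈ U)
    (hRinj : ∀ e ∈ R, ∀ e' ∈ R, D.src e = D.src e' → D.tgt e = D.tgt e' → e = e')
    (hU : c / 64 * Fintype.card V ≤ U.card)
    (hin : ∀ v, ((Finset.univ.filter fun e => D.tgt e = v).card : ℝ) ≤ Fintype.card V)
    (hout : ∀ v, ((Finset.univ.filter fun e => D.src e = v).card : ℝ) ≤ Fintype.card V)
    (hE : (Fintype.card E : ℝ) ≤ Fintype.card V * U.card)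
    (hR : c * Fintype.card V * U.card / 2 ≤ R.card)
    (hcut : ∀ S : Finset V, c / 64 * Fintype.card V ≤ (S ∩ U).card →
      c / 64 * Fintype.card V ≤ (U \ S).card → c ^ 2 / 128 * (Fintype.card V) ^ 2 ≤
        ((R.filter fun e => (D.src e ∈ S ∧ D.tgt e ∉ S) ∨ (D.src e ∉ S ∧ D.tgt e ∈ S)).card : ℝ)) :
    ∃ (b : Fin s → V) (P : Fin s × Fin s → List E), Function.Injective b ∧
      (∀ k, D.IsWalk (b k.1) (P k) (b k.2)) ∧
      Pairwise fun k k' => (P k).Disjoint (P k') := by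
  classical
  set n : ℝ := (Fintype.card V : ℝ) with hn
  have hs1' : (1 : ℝ) ≤ s := by exact_mod_cast hs1
  have hn0 : 0 < n := by
    by_contra! h
    have : 4 / 10 ^ 8 * c ^ 4 * n ≤ 0 := mul_nonpos_of_nonneg_of_nonpos (by positivity) h
    linarith
  have hcn : c ^ 4 * n ≤ c * n :=
    mul_le_mul_of_nonneg_right (pow_le_of_le_one hc.le hc1 (by norm_num)) hn0.le
  have hcn3 : c ^ 3 * n ≤ c * n :=
    mul_le_mul_of_nonneg_right (pow_le_of_le_one hc.le hc1 (by norm_num)) hn0.le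
  -- the edges of `R` at vertices of large out-degree
  set F := R.filter fun e => c * n / 4 ≤ (R.filter fun e' => D.src e' = D.src e).card with hFdef
  have hFR : ∀ e ∈ F, e ∈ R := fun e he => (Finset.mem_filter.1 he).1
  -- Membership in `F` depends only on the source, so `F` keeps all edges of `R` leaving any source
  -- it retains.
  have hFdeg : ∀ e ∈ F, c * n / 4 ≤ (F.filter fun e' => D.src e' = D.src e).card := by
    intro e he
    refine (Finset.mem_filter.1 he).2.trans (Nat.cast_le.2 (Finset.card_le_card fun e' he' => ?_))
    obtain ⟨h1, h2⟩ := Finset.mem_filter.1 he'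
    refine Finset.mem_filter.2 ⟨Finset.mem_filter.2 ⟨h1, ?_⟩, h2⟩
    rw [h2]
    exact (Finset.mem_filter.1 he).2
  have hF : c * n * U.card / 4 ≤ F.card := by
    have h1 : ((R.filter fun e => ¬ c * n / 4 ≤
        (R.filter fun e' => D.src e' = D.src e).card).card : ℝ) ≤ U.card * (c * n / 4) := by
      rw [Finset.card_eq_sum_card_fiberwise (f := D.src) (t := U)
        (fun e he => (hRU e (Finset.mem_filter.1 he).1).1), Nat.cast_sum, ← nsmul_eq_mul]
      refine Finset.sum_le_card_nsmul _ _ _ fun v _ => ?_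
      rcases Finset.eq_empty_or_nonempty ((R.filter fun e => ¬ c * n / 4 ≤
        (R.filter fun e' => D.src e' = D.src e).card).filter fun e => D.src e = v) with h | ⟨e, he⟩
      · rw [h, Finset.card_empty, Nat.cast_zero]; positivity
      · obtain ⟨h2, rfl⟩ := Finset.mem_filter.1 he
        refine le_trans ?_ (not_le.1 (Finset.mem_filter.1 h2).2).le
        exact Nat.cast_le.2 (Finset.card_le_card
          (Finset.filter_subset_filter _ (Finset.filter_subset _ _)))
    have h2 : (F.card : ℝ) + (R.filter fun e => ¬ c * n / 4 ≤
        (R.filter fun e' => D.src e' = D.src e).card).card = R.card := by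
      exact_mod_cast Finset.card_filter_add_card_filter_not _
    linarith
  obtain ⟨ret, τ, hret, hτ, hretd, hretl⟩ := exists_returns σ hσ F
  obtain ⟨b, f, Y, hb, hf, hfk, hY, hYin, hYdeg⟩ := exists_terminals hc hc1 hs1 hs F U
    (fun e he => (hRU e (hFR e he)).2) hU hin hout hE hF ret τ hτ hretl
  have hEne : Nonempty E := ⟨f (⟨0, hs1⟩, ⟨0, hs1⟩)⟩
  set B := Finset.univ.image b with hBdef
  have hBcard : B.card ≤ s := Finset.card_image_le.trans (by simp)
  set Fo := F.filter fun e => D.src e ∈ B with hFo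
  -- Excluding sources in `B` makes the last edges `Fi` disjoint from the first edges `Fo`. Both are
  -- reserved through `bad`, so connecting walks cannot use them.
  set Fi := F.filter fun e => D.tgt e ∈ Y ∧ D.src e ∉ B with hFi
  set Res := Finset.univ.biUnion fun k => (ret (f k)).toFinset with hRes
  set bad := Fo ∪ Fi ∪ Res with hbad
  -- Crossing edges of `R` number at least `c ^ 2 * n ^ 2 / 128`, so at least `c ^ 2 * n ^ 2 / 256`
  -- edges leave the set. Forbidding `c ^ 2 * n ^ 2 / 512` leaves as many, hence `δ = c ^ 2 * n /
  -- 512`, and `K` is chosen so that `K * δ > n`.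
  set K := ⌊512 / c ^ 2⌋₊ + 1 with hK
  set m := ⌈c * n / 64⌉₊ with hm
  have hm1 : c * n / 64 ≤ m := Nat.le_ceil _
  have hm2 : (m : ℝ) < c * n / 64 + 1 := Nat.ceil_lt_add_one (by positivity)
  have hbad_card : (bad.card : ℝ) + s ^ 2 * K ≤ c ^ 2 * n ^ 2 / 512 := by
    have h1 : (Fo.card : ℝ) ≤ s * n := by
      have h : (Fo.card : ℝ) ≤ B.card * n := by
        rw [Finset.card_eq_sum_card_fiberwise (f := D.src) (s := Fo) (t := B)
          (fun e he => (Finset.mem_filter.1 he).2), Nat.cast_sum, ← nsmul_eq_mul]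
        refine Finset.sum_le_card_nsmul _ _ _ fun v _ => le_trans ?_ (hout v)
        exact Nat.cast_le.2 (Finset.card_le_card
          (Finset.filter_subset_filter _ (Finset.subset_univ _)))
      exact h.trans (mul_le_mul_of_nonneg_right (Nat.cast_le.2 hBcard) hn0.le)
    have h2 : (Fi.card : ℝ) ≤ (128 * s / c + 1) * n := by
      have h : (Fi.card : ℝ) ≤ Y.card * n := by
        rw [Finset.card_eq_sum_card_fiberwise (f := D.tgt) (s := Fi) (t := Y)
          (fun e he => (Finset.mem_filter.1 he).2.1), Nat.cast_sum, ← nsmul_eq_mul]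
        refine Finset.sum_le_card_nsmul _ _ _ fun v _ => le_trans ?_ (hin v)
        exact Nat.cast_le.2 (Finset.card_le_card
          (Finset.filter_subset_filter _ (Finset.subset_univ _)))
      exact h.trans (mul_le_mul_of_nonneg_right hY hn0.le)
    have h3 : (Res.card : ℝ) ≤ s ^ 2 * (8 / c) := by
      calc (Res.card : ℝ) ≤ ∑ k : Fin s × Fin s, ((ret (f k)).toFinset.card : ℝ) := by
            exact_mod_cast Finset.card_biUnion_le
        _ ≤ ∑ _k : Fin s × Fin s, 8 / c := Finset.sum_le_sum fun k _ =>
            le_trans (Nat.cast_le.2 (List.toFinset_card_le _)) (hfk k).2.1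
        _ = _ := by simp [sq]
    have h4 : (bad.card : ℝ) ≤ Fo.card + Fi.card + Res.card := by
      exact_mod_cast (Finset.card_union_le _ _).trans
        (Nat.add_le_add_right (Finset.card_union_le _ _) _)
    have h5 : (K : ℝ) ≤ 512 / c ^ 2 + 1 := by
      rw [hK]
      push_cast
      have := Nat.floor_le (a := 512 / c ^ 2) (by positivity)
      linarith
    have h6 : (s : ℝ) ^ 2 * K ≤ s ^ 2 * (512 / c ^ 2 + 1) :=
      mul_le_mul_of_nonneg_left h5 (by positivity)
    -- In terms of `u = s / c`, every contribution is a multiple of `u * n` or `u ^ 2`, both tiny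
    -- against `c ^ 2 * n ^ 2`. The stray term `n` is absorbed using `1 ≤ s`.
    set u := (s : ℝ) / c with hu
    have hsu : (s : ℝ) = u * c := by rw [hu]; field_simp
    have hu0 : 0 ≤ u := by positivity
    have hu1 : u ≤ 4 / 10 ^ 8 * (c ^ 3 * n) := by
      rw [hu, div_le_iff₀ hc]; linarith
    have hu2 : u ≤ 4 / 10 ^ 8 * (c * n) := hu1.trans (mul_le_mul_of_nonneg_left hcn3 (by norm_num))
    have hu3 : u ^ 2 ≤ (4 / 10 ^ 8) ^ 2 * (c ^ 2 * n ^ 2) := by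
      calc u ^ 2 ≤ (4 / 10 ^ 8 * (c * n)) ^ 2 := pow_le_pow_left₀ hu0 hu2 2
        _ = _ := by ring
    have hu4 : u * n ≤ 4 / 10 ^ 8 * (c ^ 2 * n ^ 2) := by
      have h : c ^ 3 * n ≤ c ^ 2 * n :=
        mul_le_mul_of_nonneg_right (pow_le_pow_of_le_one hc.le hc1 (by norm_num)) hn0.le
      calc u * n ≤ 4 / 10 ^ 8 * (c ^ 3 * n) * n := mul_le_mul_of_nonneg_right hu1 hn0.le
        _ ≤ 4 / 10 ^ 8 * (c ^ 2 * n) * n := by gcongr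
        _ = _ := by ring
    have hsle : (s : ℝ) ≤ u := by
      rw [hsu]; exact mul_le_of_le_one_right hu0 hc1
    have h7 : (s : ℝ) * n ≤ u * n := mul_le_mul_of_nonneg_right hsle hn0.le
    have h8 : n ≤ s * n := le_mul_of_one_le_left hn0.le hs1'
    have h9 : (128 * s / c + 1) * n = 128 * (u * n) + n := by rw [hu]; ring
    have h10 : (s : ℝ) ^ 2 * (8 / c) = 8 * (s * u) := by rw [hu]; ring
    have h11 : (s : ℝ) * u ≤ u ^ 2 := by rw [sq]; exact mul_le_mul_of_nonneg_right hsle hu0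
    have h12 : (s : ℝ) ^ 2 * (512 / c ^ 2 + 1) = 512 * u ^ 2 + s ^ 2 := by rw [hu]; ring
    have h13 : (s : ℝ) ^ 2 ≤ u ^ 2 := pow_le_pow_left₀ (by positivity) hsle 2
    have h14 : 0 ≤ c ^ 2 * n ^ 2 := by positivity
    linarith
  have hroute : ∀ (A : Finset E) (X X' : Finset V), A.card ≤ bad.card + s ^ 2 * K → X ⊆ U →
      X' ⊆ U → m ≤ X.card → m ≤ X'.card →
      ∃ x ∈ X, ∃ y ∈ X', ∃ p, D.IsWalk x p y ∧ (∀ e ∈ p, e ∉ A) ∧ p.length ≤ K := by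
    intro A X X' hA hXU hXU' hX hX'
    have hA' : (A.card : ℝ) ≤ c ^ 2 * n ^ 2 / 512 := by
      refine le_trans ?_ hbad_card
      exact_mod_cast hA
    refine exists_short_walk (N := n) (δ := c ^ 2 * n / 512) hn0 A X X' hin (fun S hXS hSX' => ?_) ?_
    · have h1 : c / 64 * n ≤ (S ∩ U).card := by
        have : m ≤ (S ∩ U).card := hX.trans (Finset.card_le_card (Finset.subset_inter hXS hXU))
        have : (m : ℝ) ≤ (S ∩ U).card := by exact_mod_cast this
        linarith
      have h2 : c / 64 * n ≤ (U \ S).card := by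
        have : m ≤ (U \ S).card := hX'.trans (Finset.card_le_card fun x hx =>
          Finset.mem_sdiff.2 ⟨hXU' hx, fun hxS => Finset.disjoint_left.1 hSX' hxS hx⟩)
        have : (m : ℝ) ≤ (U \ S).card := by exact_mod_cast this
        linarith
      have h3 := hcut S h1 h2
      have h4 : (R.filter fun e => (D.src e ∈ S ∧ D.tgt e ∉ S) ∨
          (D.src e ∉ S ∧ D.tgt e ∈ S)).card ≤
          2 * (Finset.univ.filter fun e => D.src e ∈ S ∧ D.tgt e ∉ S).card := by
        rw [two_mul]
        nth_rewrite 2 [card_cut_eq σ hσ S]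
        rw [Finset.filter_or]
        exact (Finset.card_union_le _ _).trans (Nat.add_le_add
          (Finset.card_le_card (Finset.filter_subset_filter _ (Finset.subset_univ _)))
          (Finset.card_le_card (Finset.filter_subset_filter _ (Finset.subset_univ _))))
      have h5 : (Finset.univ.filter fun e => D.src e ∈ S ∧ D.tgt e ∉ S).card ≤
          (Finset.univ.filter fun e => (D.src e ∈ S ∧ D.tgt e ∉ S) ∧ e ∉ A).card + A.card := by
        rw [← Finset.filter_filter (fun e => D.src e ∈ S ∧ D.tgt e ∉ S), Finset.filter_notMem_eq_sdiff]
        have := Finset.le_card_sdiff A (Finset.univ.filter fun e => D.src e ∈ S ∧ D.tgt e ∉ S)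
        omega
      have h4' : ((R.filter fun e => (D.src e ∈ S ∧ D.tgt e ∉ S) ∨
          (D.src e ∉ S ∧ D.tgt e ∈ S)).card : ℝ) ≤
          2 * (Finset.univ.filter fun e => D.src e ∈ S ∧ D.tgt e ∉ S).card := by
        exact_mod_cast h4
      have h5' : ((Finset.univ.filter fun e => D.src e ∈ S ∧ D.tgt e ∉ S).card : ℝ) ≤
          (Finset.univ.filter fun e => (D.src e ∈ S ∧ D.tgt e ∉ S) ∧ e ∉ A).card + A.card := by
        exact_mod_cast h5
      linarith
    · have h1 := Nat.lt_floor_add_one (512 / c ^ 2)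
      have h2 : (512 / c ^ 2) * (c ^ 2 * n / 512) = n := by field_simp
      rw [hK]
      push_cast
      calc n = (512 / c ^ 2) * (c ^ 2 * n / 512) := h2.symm
        _ < _ := mul_lt_mul_of_pos_right h1 (by positivity)
  have hsrcB : ∀ k, D.src (τ (f k)) = b k.2 := fun k => (hfk k).2.2.1
  have hbF : ∀ i, c * n / 4 ≤ (Fo.filter fun e => D.src e = b i).card := by
    intro i
    have h1 := hFdeg _ (hret _ (hfk (i, i)).1).1
    rw [hsrcB] at h1
    refine h1.trans (Nat.cast_le.2 (Finset.card_le_card fun e he => ?_))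
    obtain ⟨h2, h3⟩ := Finset.mem_filter.1 he
    refine Finset.mem_filter.2 ⟨Finset.mem_filter.2 ⟨h2, ?_⟩, h3⟩
    rw [h3]
    exact Finset.mem_image_of_mem _ (Finset.mem_univ _)
  -- Passing from `F` to `Fi` loses at most `s` edges at a vertex, because `R` has no parallel edges
  -- and `B` has at most `s` vertices.
  have hyF : ∀ k, c * n / 16 - s ≤ (Fi.filter fun e => D.tgt e = D.tgt (f k)).card := by
    intro k
    have h1 := hYdeg k
    have h2 : (F.filter fun e => D.tgt e = D.tgt (f k)).card ≤
        (Fi.filter fun e => D.tgt e = D.tgt (f k)).card + s := by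
      rw [← Finset.card_filter_add_card_filter_not (s := F.filter fun e => D.tgt e = D.tgt (f k))
        (fun e => D.src e ∉ B)]
      refine Nat.add_le_add (Finset.card_le_card fun e he => ?_) (le_trans ?_ hBcard)
      · obtain ⟨h3, h4⟩ := Finset.mem_filter.1 he
        obtain ⟨h5, h6⟩ := Finset.mem_filter.1 h3
        exact Finset.mem_filter.2 ⟨Finset.mem_filter.2 ⟨h5, h6 ▸ (hfk k).2.2.2, h4⟩, h6⟩
      · refine Finset.card_le_card_of_injOn D.src ?_ ?_
        · intro e he
          simp only [Finset.coe_filter, Set.mem_ofPred_eq, not_not] at he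
          exact he.2
        · intro e he e' he' hee
          simp only [Finset.coe_filter, Finset.mem_filter, Set.mem_ofPred_eq] at he he'
          exact hRinj e (hFR e he.1.1) e' (hFR e' he'.1.1) hee (he.1.2.trans he'.1.2.symm)
    have h2' : ((F.filter fun e => D.tgt e = D.tgt (f k)).card : ℝ) ≤
        (Fi.filter fun e => D.tgt e = D.tgt (f k)).card + s := by exact_mod_cast h2
    linarith
  have hFoF : ∀ e ∈ Fo, e ∈ F := fun e he => (Finset.mem_filter.1 he).1
  have hFiF : ∀ e ∈ Fi, e ∈ F := fun e he => (Finset.mem_filter.1 he).1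
  obtain ⟨a, z, p, ha, hz, hp, hk⟩ := exists_disjoint_connections (D := D)
    (fun k : Fin s × Fin s => b k.1) (fun k => D.tgt (f k)) Fo Fi bad U (K := K)
    (M := bad.card + s ^ 2 * K) (m := m) hroute (by simp [sq])
    (fun e he => (hRU e (hFR e (hFoF e he))).2) (fun e he => (hRU e (hFR e (hFiF e he))).1)
    (fun k e he e' he' hee => hRinj e (hFR e (hFoF e he.1)) e' (hFR e' (hFoF e' he'.1))
      (he.2.trans he'.2.symm) hee)
    (fun k e he e' he' hee => hRinj e (hFR e (hFiF e he.1)) e' (hFR e' (hFiF e' he'.1))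
      hee (he.2.trans he'.2.symm))
    (fun k => by
      have h1 : (Finset.univ.filter fun k' : Fin s × Fin s => b k'.1 = b k.1).card ≤ s := by
        refine le_trans (Finset.card_le_card_of_injOn (t := Finset.univ) Prod.snd
          (fun _ _ => Finset.mem_coe.2 (Finset.mem_univ _)) ?_) (by simp)
        rintro ⟨i, j⟩ hi ⟨i', j'⟩ hi' hj
        simp only [Finset.coe_filter, Finset.mem_univ, true_and, Set.mem_ofPred_eq] at hi hi'
        exact Prod.ext (hb (hi.trans hi'.symm)) hj
      have h2 := hbF k.1
      have h3 : ((m + s : ℕ) : ℝ) ≤ (Fo.filter fun e => D.src e = b k.1).card := by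
        push_cast
        linarith
      have h4 : m + s ≤ (Fo.filter fun e => D.src e = b k.1).card := by exact_mod_cast h3
      exact (Nat.add_le_add_left h1 m).trans h4)
    (fun k => by
      have h1 := hYin k
      have h2 := hyF k
      have h3 : ((m + (Finset.univ.filter fun k' => D.tgt (f k') = D.tgt (f k)).card : ℕ) : ℝ) ≤
          (Fi.filter fun e => D.tgt e = D.tgt (f k)).card := by
        push_cast
        linarith
      exact_mod_cast h3)
  refine ⟨b, fun k => a k :: (p k ++ (z k :: ret (f k))), hb, fun k => ?_, fun k k' hkk' => ?_⟩
  · obtain ⟨h1, h2, h3, h4, h5, h6⟩ := hk k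
    refine ⟨h2, h5.append ⟨rfl, ?_⟩⟩
    rw [h4, ← hsrcB k]
    exact (hret _ (hfk k).1).2.1
  · have mem : ∀ k e, e ∈ a k :: (p k ++ (z k :: ret (f k))) →
        e = a k ∨ e ∈ p k ∨ e = z k ∨ e ∈ ret (f k) := fun k e he => by simpa using he
    have haz : ∀ k k', a k ≠ z k' := by
      intro k k' h
      have h1 := (Finset.mem_filter.1 (hk k').2.2.1).2.2
      rw [← h] at h1
      exact h1 (Finset.mem_filter.1 (hk k).1).2
    have hap : ∀ k k', a k ∉ p k' := fun k k' h => (hk k').2.2.2.2.2 _ h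
      (Finset.mem_union_left _ (Finset.mem_union_left _ (hk k).1))
    have hzp : ∀ k k', z k ∉ p k' := fun k k' h => (hk k').2.2.2.2.2 _ h
      (Finset.mem_union_left _ (Finset.mem_union_right _ (hk k).2.2.1))
    have har : ∀ k k', a k ∉ ret (f k') := fun k k' h =>
      (hret _ (hfk k').1).2.2 _ h (hFoF _ (hk k).1)
    have hzr : ∀ k k', z k ∉ ret (f k') := fun k k' h =>
      (hret _ (hfk k').1).2.2 _ h (hFiF _ (hk k).2.2.1)
    have hpr : ∀ k k' e, e ∈ p k → e ∉ ret (f k') := fun k k' e he he' =>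
      (hk k).2.2.2.2.2 e he (Finset.mem_union_right _ (Finset.mem_biUnion.2
        ⟨k', Finset.mem_univ _, List.mem_toFinset.2 he'⟩))
    intro e he he'
    rcases mem k e he with rfl | h | rfl | h <;> rcases mem k' _ he' with h' | h' | h' | h'
    · exact hkk' (ha h')
    · exact hap _ _ h'
    · exact haz _ _ h'
    · exact har _ _ h'
    · exact hap _ _ (h' ▸ h)
    · exact hp hkk' h h'
    · exact hzp _ _ (h' ▸ h)
    · exact hpr _ _ _ h h'
    · exact haz _ _ h'.symm
    · exact hzp _ _ h'
    · exact hkk' (hz h')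
    · exact hzr _ _ h'
    · exact har _ _ (h' ▸ h)
    · exact hpr _ _ _ h' h
    · exact hzr _ _ (h' ▸ h)
    · exact hretd _ (hfk k).1 _ (hfk k').1 (fun h => hkk' (hf h)) h h'

end Core

end MultiDigraph
-- Degree bounds after reduction and the main theorem.
namespace MultiDigraph

universe u
variable {V : Type*} {E : Type u} [Fintype V]

theorem card_filter_tgt_eq_le [DecidableEq V] {D : MultiDigraph V E} (A : Finset E) (w : V)
    (hA : ∀ e ∈ A, ∀ e' ∈ A, D.src e = D.src e' → D.tgt e = D.tgt e' → e = e') :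
    (A.filter fun e => D.tgt e = w).card ≤ Fintype.card V := by
  refine Finset.card_le_card_of_injOn D.src (fun _ _ => Finset.mem_coe.2 (Finset.mem_univ _)) ?_
  intro e he e' he' h
  simp only [Finset.coe_filter, Set.mem_ofPred_eq] at he he'
  exact hA e he.1 e' he'.1 h (he.2.trans he'.2.symm)

theorem card_filter_src_eq_le [DecidableEq V] {D : MultiDigraph V E} (A : Finset E) (w : V)
    (hA : ∀ e ∈ A, ∀ e' ∈ A, D.src e = D.src e' → D.tgt e = D.tgt e' → e = e') :
    (A.filter fun e => D.src e = w).card ≤ Fintype.card V := by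
  refine Finset.card_le_card_of_injOn D.tgt (fun _ _ => Finset.mem_coe.2 (Finset.mem_univ _)) ?_
  intro e he e' he' h
  simp only [Finset.coe_filter, Set.mem_ofPred_eq] at he he'
  exact hA e he.1 e' he'.1 (he.2.trans he'.2.symm) h

theorem mul_minDegree_le_card_interedges [DecidableEq V] (G : SimpleGraph V)
    [DecidableRel G.Adj] :
    Fintype.card V * G.minDegree ≤ (G.interedges Finset.univ Finset.univ).card := by
  rw [Finset.card_eq_sum_card_fiberwise (f := Prod.fst) (t := Finset.univ)
    (fun _ _ => Finset.mem_coe.2 (Finset.mem_univ _)), ← Finset.card_univ, ← smul_eq_mul]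
  refine Finset.card_nsmul_le_sum _ _ _ fun v _ => (G.minDegree_le_degree v).trans ?_
  refine Finset.card_le_card_of_injOn (fun w => (v, w)) ?_ ?_
  · intro w hw
    simpa [SimpleGraph.mem_interedges_iff] using hw
  · intro w _ w' _ h
    exact (Prod.ext_iff.1 h).2

/-- The core of the theorem, for a positive density `2 * c`. -/
theorem immerses_complete_of_minDegree [Fintype E] (D : MultiDigraph V E)
    [DecidableRel D.underlyingSimpleGraph.Adj] (hD : D.IsEulerian) {c : ℝ} {s : ℕ} (hc : 0 < c)
    (hc1 : c ≤ 1) (hs1 : 1 ≤ s) (hs : (s : ℝ) ≤ 4 / 10 ^ 8 * c ^ 4 * Fintype.card V)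
    (hdeg : 2 * c * Fintype.card V ≤ D.underlyingSimpleGraph.minDegree) :
    D.Immerses (MultiDigraph.complete s) := by
  classical
  set G := D.underlyingSimpleGraph with hG
  have hs1' : (1 : ℝ) ≤ s := by exact_mod_cast hs1
  have hn0 : 0 < (Fintype.card V : ℝ) := by
    by_contra! h
    have : 4 / 10 ^ 8 * c ^ 4 * (Fintype.card V : ℝ) ≤ 0 :=
      mul_nonpos_of_nonneg_of_nonpos (by positivity) h
    linarith
  have : Nonempty V := Fintype.card_pos_iff.1 (by exact_mod_cast hn0)
  have hGcard : 2 * c * (Fintype.card V : ℝ) ^ 2 ≤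
      (G.interedges Finset.univ Finset.univ).card := by
    have h1 : (Fintype.card V : ℝ) * G.minDegree ≤
        (G.interedges Finset.univ Finset.univ).card := by
      exact_mod_cast mul_minDegree_le_card_interedges G
    have hdeg' : 2 * c * (Fintype.card V : ℝ) ≤ G.minDegree := by convert hdeg
    have h2 := mul_le_mul_of_nonneg_left hdeg' hn0.le
    linarith
  -- With these parameters the error `2 * ε * n ^ 2` equals `c * n * (κ * n)`, at most `c * n *
  -- U.card`. So `U` still spans at least `c * n * U.card` ordered adjacent pairs, and `R` has at
  -- least half as many edges.
  obtain ⟨U, hU, hUcard, hUcut⟩ := G.exists_cut_dense_set (κ := c / 64) (ε := c ^ 2 / 128)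
    (by positivity) (by linarith) hGcard (by positivity)
  let G' : SimpleGraph V :=
    { Adj := fun x y => G.Adj x y ∧ x ∈ U ∧ y ∈ U
      symm := ⟨fun x y h => ⟨h.1.symm, h.2.2, h.2.1⟩⟩
      loopless := ⟨fun x h => G.loopless.irrefl x h.1⟩ }
  obtain ⟨σ, hσ⟩ := hD.exists_perm
  have hr : ∀ x : G'.edgeSet, ∃ e, s(D.src e, D.tgt e) = x.1 := by
    rintro ⟨x, hx⟩
    induction x using Sym2.ind with
    | _ x y =>
      have h : G.Adj x y := (G'.mem_edgeSet.1 hx).1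
      obtain ⟨-, ⟨e, h1, h2⟩ | ⟨e, h1, h2⟩⟩ := (SimpleGraph.fromRel_adj _ _ _).1 h
      · exact ⟨e, by rw [h1, h2]⟩
      · exact ⟨e, by rw [h1, h2, Sym2.eq_swap]⟩
  choose r hr using hr
  obtain ⟨E', _, D', σ', r', hσ', hr', himm, hmin⟩ :=
    exists_reduction G' (Fintype.card E) E le_rfl D σ hσ r hr
  set R := Finset.univ.image r' with hR
  have hRmem : ∀ e, e ∈ R ↔ e ∈ Set.range r' := fun e => by simp [hR]
  have hRU : ∀ e ∈ R, D'.src e ∈ U ∧ D'.tgt e ∈ U := by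
    intro e he
    obtain ⟨x, rfl⟩ := (hRmem e).1 he
    have h : s(D'.src (r' x), D'.tgt (r' x)) ∈ G'.edgeSet := by rw [hr']; exact x.2
    exact (G'.mem_edgeSet.1 h).2
  have hRinj : ∀ e ∈ R, ∀ e' ∈ R, D'.src e = D'.src e' → D'.tgt e = D'.tgt e' → e = e' := by
    intro e he e' he' h1 h2
    obtain ⟨x, rfl⟩ := (hRmem e).1 he
    obtain ⟨y, rfl⟩ := (hRmem e').1 he'
    congr 1
    rw [← Subtype.coe_inj, ← hr', ← hr', h1, h2]
  have hinout : ∀ v, (Finset.univ.filter fun e => D'.tgt e = v).card =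
      (Finset.univ.filter fun e => D'.src e = v).card := fun v =>
    Finset.card_equiv σ' fun e => by simp [hσ']
  have hout : ∀ v, (Finset.univ.filter fun e => D'.src e = v).card ≤ Fintype.card V := by
    intro v
    rcases hmin v with h | h
    · rw [← hinout]
      refine le_trans (Finset.card_le_card fun e he => ?_) (card_filter_tgt_eq_le R v hRinj)
      have he := (Finset.mem_filter.1 he).2
      exact Finset.mem_filter.2 ⟨(hRmem e).2 (h e he), he⟩
    · refine le_trans (Finset.card_le_card fun e he => ?_) (card_filter_src_eq_le R v hRinj)
      have he := (Finset.mem_filter.1 he).2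
      exact Finset.mem_filter.2 ⟨(hRmem e).2 (h e he), he⟩
  -- Either `e` itself or its predecessor under `σ'` is a representative, and representatives have
  -- both ends in `U`. This bounds the number of edges by `n * U.card`.
  have hsrcU : ∀ e, D'.src e ∈ U := by
    intro e
    rcases hmin (D'.src e) with h | h
    · have h1 : D'.tgt (σ'.symm e) = D'.src e := by rw [← hσ', Equiv.apply_symm_apply]
      rw [← h1]
      exact (hRU _ ((hRmem _).2 (h _ h1))).2
    · exact (hRU e ((hRmem e).2 (h e rfl))).1
  have hE : Fintype.card E' ≤ Fintype.card V * U.card := by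
    rw [← Finset.card_univ, Finset.card_eq_sum_card_fiberwise (f := D'.src) (t := U)
      (fun e _ => hsrcU e), mul_comm, ← smul_eq_mul]
    exact Finset.sum_le_card_nsmul _ _ _ fun v _ => hout v
  have hadj : ∀ x ∈ U, ∀ y ∈ U, G.Adj x y → ∃ e ∈ R,
      (D'.src e = x ∧ D'.tgt e = y) ∨ (D'.src e = y ∧ D'.tgt e = x) := by
    intro x hx y hy h
    have hxy : s(x, y) ∈ G'.edgeSet := G'.mem_edgeSet.2 ⟨h, hx, hy⟩
    exact ⟨r' ⟨_, hxy⟩, (hRmem _).2 ⟨_, rfl⟩, Sym2.eq_iff.1 (hr' ⟨_, hxy⟩)⟩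
  have hRcard : (G.interedges U U).card ≤ 2 * R.card := by
    rw [two_mul]
    refine le_trans (Finset.card_le_card (t := R.image (fun e => (D'.src e, D'.tgt e)) ∪
      R.image fun e => (D'.tgt e, D'.src e)) ?_) ((Finset.card_union_le _ _).trans
        (Nat.add_le_add Finset.card_image_le Finset.card_image_le))
    rintro ⟨x, y⟩ hxy
    obtain ⟨hx, hy, h⟩ := (G.mk_mem_interedges_iff).1 hxy
    obtain ⟨e, he, ⟨rfl, rfl⟩ | ⟨rfl, rfl⟩⟩ := hadj x hx y hy h
    · exact Finset.mem_union_left _ (Finset.mem_image_of_mem _ he)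
    · exact Finset.mem_union_right _
        (Finset.mem_image_of_mem (fun e => (D'.tgt e, D'.src e)) he)
  have hcut : ∀ S : Finset V, (G.interedges (S ∩ U) (U \ (S ∩ U))).card ≤
      (R.filter fun e => (D'.src e ∈ S ∧ D'.tgt e ∉ S) ∨ (D'.src e ∉ S ∧ D'.tgt e ∈ S)).card := by
    intro S
    refine le_trans (Finset.card_le_card ?_) (Finset.card_image_le
      (f := fun e => if D'.src e ∈ S then (D'.src e, D'.tgt e) else (D'.tgt e, D'.src e)))
    rintro ⟨x, y⟩ hxy
    obtain ⟨hx, hy, h⟩ := (G.mk_mem_interedges_iff).1 hxy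
    obtain ⟨hxS, hxU⟩ := Finset.mem_inter.1 hx
    obtain ⟨hyU, hyS⟩ := Finset.mem_sdiff.1 hy
    have hyS : y ∉ S := fun h => hyS (Finset.mem_inter.2 ⟨h, hyU⟩)
    obtain ⟨e, he, ⟨rfl, rfl⟩ | ⟨rfl, rfl⟩⟩ := hadj x hxU y hyU h
    · exact Finset.mem_image.2 ⟨e, Finset.mem_filter.2 ⟨he, .inl ⟨hxS, hyS⟩⟩, if_pos hxS⟩
    · exact Finset.mem_image.2 ⟨e, Finset.mem_filter.2 ⟨he, .inr ⟨hyS, hxS⟩⟩, if_neg hyS⟩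
  obtain ⟨b, P, hb, hP, hPd⟩ := exists_linked_vertices hc hc1 hs1 hs σ' hσ' R U hRU hRinj hU
    (fun v => by rw [hinout]; exact_mod_cast hout v) (fun v => by exact_mod_cast hout v)
    (by exact_mod_cast hE)
    (by
      have h1 : ((G.interedges U U).card : ℝ) ≤ 2 * R.card := by exact_mod_cast hRcard
      have h2 := mul_le_mul_of_nonneg_left hU (mul_pos hc hn0).le
      linarith)
    (fun S h1 h2 => by
      have h3 : U \ (S ∩ U) = U \ S := by ext; simp
      exact (hUcut (S ∩ U) Finset.inter_subset_right h1 (by rw [h3]; exact h2)).trans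
        (Nat.cast_le.2 (hcut S)))
  exact himm.immerses_of_walks b hb (fun e => P e.1) (fun e => hP e.1)
    fun e e' he => hPd fun h => he (Subtype.ext h)

end MultiDigraph

theorem theorem4p3 {V E : Type*} [Fintype V] [Fintype E] (D : MultiDigraph V E)
    [DecidableRel D.underlyingSimpleGraph.Adj] (hD : D.IsEulerian)
    (α : ℝ) (hα : 0 ≤ α)
    (hdeg : α * (Fintype.card V : ℝ) ≤ (D.underlyingSimpleGraph.minDegree : ℝ)) :
    D.Immerses
      (MultiDigraph.complete ⌈(10 : ℝ) ^ (-9 : ℤ) * α ^ 4 * (Fintype.card V : ℝ)⌉₊) := by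
  set x : ℝ := (10 : ℝ) ^ (-9 : ℤ) * α ^ 4 * (Fintype.card V : ℝ) with hx
  have hx' : x = 1 / 10 ^ 9 * α ^ 4 * Fintype.card V := by
    rw [hx, zpow_neg, one_div]; norm_cast
  -- For `x ≤ 1` the target digraph has no edges, and an empty `V` forces `x = 0`. For `x > 1` the
  -- rounding is harmless: `⌈x⌉₊ < x + 1 < 2 * x`, below the `5 / 2 * x` allowed for `c = α / 2`.
  rcases le_or_gt x 1 with hx1 | hx1
  · have hs : ⌈x⌉₊ ≤ 1 := Nat.ceil_le.2 (by simpa using hx1)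
    have hsub : Subsingleton (Fin ⌈x⌉₊) := Fin.subsingleton_iff_le_one.2 hs
    have hemb : Nonempty (Fin ⌈x⌉₊ → V) := by
      rcases isEmpty_or_nonempty V with h | ⟨⟨v⟩⟩
      · have h0 : x = 0 := by rw [hx, Fintype.card_eq_zero, Nat.cast_zero, mul_zero]
        rw [h0, Nat.ceil_zero]
        exact ⟨Fin.elim0⟩
      · exact ⟨fun _ => v⟩
    obtain ⟨f⟩ := hemb
    have hno : ∀ p : {p : Fin ⌈x⌉₊ × Fin ⌈x⌉₊ // p.1 ≠ p.2}, False := fun p =>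
      p.2 (Subsingleton.elim _ _)
    exact ⟨f, fun p => (hno p).elim, Function.injective_of_subsingleton f,
      fun p => (hno p).elim, fun p => (hno p).elim⟩
  · have hn0 : 0 < (Fintype.card V : ℝ) := by
      rcases (Nat.cast_nonneg (α := ℝ) (Fintype.card V)).eq_or_lt with h | h
      · rw [hx', ← h, mul_zero] at hx1
        linarith
      · exact h
    have hα0 : 0 < α := by
      rcases hα.eq_or_lt with h | h
      · rw [hx', ← h] at hx1
        norm_num at hx1
      · exact h
    have : Nonempty V := Fintype.card_pos_iff.1 (by exact_mod_cast hn0)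
    have hα1 : α ≤ 1 := by
      have h1 : (D.underlyingSimpleGraph.minDegree : ℝ) ≤ Fintype.card V := by
        exact_mod_cast D.underlyingSimpleGraph.minDegree_lt_card.le
      refine le_of_mul_le_mul_right ?_ hn0
      linarith
    refine D.immerses_complete_of_minDegree hD (c := α / 2) (by positivity) (by linarith)
      (Nat.ceil_pos.2 (by linarith)) ?_ (by linarith)
    have h1 := Nat.ceil_lt_add_one (a := x) (by linarith)
    have h2 : 4 / 10 ^ 8 * (α / 2) ^ 4 * (Fintype.card V : ℝ) = 5 / 2 * x := by
      rw [hx']; ring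
    linarith
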